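/- Let $k$ be an algebraically closed field of characteristic zero, $G$ a finite group, $S\subseteq G$ a subgroup, and $\alpha: S\times S\to k^{*}$ a 2-cocycle (trivial action of $S$ on $k^*$) which is non-degenerate, i.e. $1$ is the only $s\in S$ such that $\alpha(s,t)=\alpha(t,s)$ for all $t\in C_S(s)$. Let $k_\alpha S$ be the twisted group algebra, with basis $(x_s)_{s\in S}$ and multiplication $x_sx_t=\alpha(s,t)x_{st}$, on which $S$ acts by $s\triangleright a=x_s a x_s^{-1}$. Let $$A=A(G,S,\alpha)=\{f:G\to k_\alpha S \;:\; f(sg)=s\triangleright f(g)\ \text{ for all } s\in S,\ g\in G\}$$ with pointwise operations and the $G$-action $(g\cdot f)(h)=f(hg)$. Let $k^G$ be the Hopf algebra of functions $G\to k$, with basis of idempotents $(e_g)_{g\in G}$, coacting on $A$ by $\rho(a)=\sum_{g\in G} g\cdot a\otimes e_g$. Then $A$ is a right $k^G$-Galois object: its coinvariants are $k$, and the canonical map $\mathrm{can}:A\otimes A\to A\otimes k^G$, $x\otimes y\mapsto (x\otimes 1)\rho(y)$, is bijective. The Miyashita–Ulbrich action of $k^G$ on $A$ is therefore defined, by $a\leftharpoonup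 h=h^{[1]}\,a\,h^{[2]}$, where $\mathrm{can}(h^{[1]}\otimes h^{[2]})=1\otimes h$. Let $G\times_S S$ be the quotient of $G\times S$ by the relation $(g,s)\sim(gt^{-1},tst^{-1})$, $t\in S$. For a subgroup $F\subseteq G$, a class $(g,s)\in G\times_S S$ is called $(\alpha,F)$-regular if $\alpha(s,t)=\alpha(t,s)$ for all $t\in C_S(s)\cap g^{-1}Fg$; this does not depend on the representative. **Theorem.** Let $F\subseteq G$ be any subgroup, not necessarily normal. The subalgebra $A^F$ of $F$-invariants is a $k^G$-submodule of $A$ under the Miyashita–Ulbrich action if and only if $g^{-1}Fg\subseteq C_G(s)$ for every $(\alpha,F)$-regular class $(g,s)\in G\times_S S$. -/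

import Mathlib

open scoped TensorProduct

noncomputable section

/-- A 2-cocycle `α ∈ Z²(S, kˣ)` for the trivial action of `S` on `kˣ`. -/
structure TwoCocycle (S k : Type*) [Group S] [Field k] where
  toFun : S → S → kˣ
  cocycle : ∀ s t u : S, toFun s t * toFun (s * t) u = toFun t u * toFun s (t * u)

namespace TwoCocycle

variable {S k : Type*} [Group S] [Field k]

instance : CoeFun (TwoCocycle S k) (fun _ => S → S → kˣ) := ⟨TwoCocycle.toFun⟩

/-- `s` is `α`-regular: `α(s,t) = α(t,s)` for all `t` in the centralizer of `s`. -/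
def IsRegular (α : TwoCocycle S k) (s : S) : Prop :=
  ∀ t ∈ Subgroup.centralizer {s}, α s t = α t s

/-- `α` is non-degenerate: `1` is the only `α`-regular element. -/
def IsNondegenerate (α : TwoCocycle S k) : Prop :=
  ∀ s : S, α.IsRegular s ↔ s = 1

theorem map_one_left (α : TwoCocycle S k) (t : S) : α 1 t = α 1 1 := by
  have h := α.cocycle 1 1 t
  simp only [one_mul] at h
  rw [mul_comm] at h
  exact (mul_left_cancel h).symm

theorem map_one_right (α : TwoCocycle S k) (s : S) : α s 1 = α 1 1 := by
  have h := α.cocycle s 1 1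
  simp only [mul_one] at h
  exact mul_right_cancel h

end TwoCocycle

/-- The twisted group algebra `k_α S`: the vector space with basis `(x_s)_{s ∈ S}`. -/
def TwistedGroupAlgebra {S k : Type*} [Group S] [Field k] (_α : TwoCocycle S k) : Type _ :=
  S →₀ k

namespace TwistedGroupAlgebra

variable {S k : Type*} [Group S] [Field k] (α : TwoCocycle S k)

instance : AddCommGroup (TwistedGroupAlgebra α) := inferInstanceAs (AddCommGroup (S →₀ k))

instance : Module k (TwistedGroupAlgebra α) := inferInstanceAs (Module k (S →₀ k))

/-- The basis of `k_α S` indexed by `S`. -/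
def basis : Module.Basis S k (TwistedGroupAlgebra α) := ⟨LinearEquiv.refl k (S →₀ k)⟩

/-- The basis element `x_s`. -/
def x (s : S) : TwistedGroupAlgebra α := basis α s

/-- The bilinear multiplication with `x_s x_t = α(s,t) x_{st}`. -/
def mulHom : TwistedGroupAlgebra α →ₗ[k] TwistedGroupAlgebra α →ₗ[k] TwistedGroupAlgebra α :=
  (basis α).constr k fun s => (basis α).constr k fun t => (α s t : k) • x α (s * t)

theorem mulHom_x (s t : S) : mulHom α (x α s) (x α t) = (α s t : k) • x α (s * t) := by
  simp [mulHom, x, Module.Basis.constr_basis]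

instance : Mul (TwistedGroupAlgebra α) := ⟨fun a b => mulHom α a b⟩

/-- The identity is `α(1,1)⁻¹ x_1`; it is `x_1` when `α` is normalized. -/
instance : One (TwistedGroupAlgebra α) := ⟨((α 1 1)⁻¹ : kˣ) • x α 1⟩

theorem mul_def (a b : TwistedGroupAlgebra α) : a * b = mulHom α a b := rfl

theorem one_def : (1 : TwistedGroupAlgebra α) = (((α 1 1)⁻¹ : kˣ) : k) • x α 1 := rfl

theorem x_mul_x (s t : S) : x α s * x α t = (α s t : k) • x α (s * t) := mulHom_x α s t

variable {α} in
theorem induction {p : TwistedGroupAlgebra α → Prop} (h0 : p 0)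
    (hadd : ∀ a b, p a → p b → p (a + b)) (hx : ∀ (c : k) (s : S), p (c • x α s))
    (a : TwistedGroupAlgebra α) : p a := by
  have ha : a ∈ Submodule.span k (Set.range (basis α)) := (basis α).mem_span a
  rw [← Finsupp.range_linearCombination] at ha
  obtain ⟨f, rfl⟩ := ha
  induction f using Finsupp.induction_linear with
  | zero => simpa using h0
  | add f g hf hg => rw [map_add]; exact hadd _ _ hf hg
  | single s c => rw [Finsupp.linearCombination_single]; exact hx c s

theorem mulHom_assoc (a b c : TwistedGroupAlgebra α) :
    mulHom α (mulHom α a b) c = mulHom α a (mulHom α b c) := by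
  induction a using induction with
  | h0 => simp
  | hadd a a' h h' => simp [h, h']
  | hx r s =>
    induction b using induction with
    | h0 => simp
    | hadd a a' h h' => simp only [map_add, LinearMap.add_apply, h, h']
    | hx r' t =>
      induction c using induction with
      | h0 => simp
      | hadd a a' h h' => simp only [map_add, h, h']
      | hx r'' u =>
        have h := congrArg (Units.val) (α.cocycle s t u)
        simp only [Units.val_mul] at h
        simp only [map_smul, LinearMap.smul_apply, mulHom_x, smul_smul, mul_assoc]
        congr 1
        linear_combination (r * r' * r'') * h

theorem mulHom_one_left (a : TwistedGroupAlgebra α) : mulHom α 1 a = a := by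
  induction a using induction with
  | h0 => simp
  | hadd a a' h h' => simp [h, h']
  | hx r s =>
    simp [one_def, mulHom_x, α.map_one_left, smul_smul]

theorem mulHom_one_right (a : TwistedGroupAlgebra α) : mulHom α a 1 = a := by
  induction a using induction with
  | h0 => simp
  | hadd a a' h h' => simp [h, h']
  | hx r s =>
    simp [one_def, mulHom_x, α.map_one_right, smul_smul, mul_left_comm _ r]

instance : Ring (TwistedGroupAlgebra α) :=
  { (inferInstance : AddCommGroup (TwistedGroupAlgebra α)),
    (inferInstance : Mul (TwistedGroupAlgebra α)),
    (inferInstance : One (TwistedGroupAlgebra α)) with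
    left_distrib := fun a b c => map_add (mulHom α a) b c
    right_distrib := fun a b c => LinearMap.map_add₂ (mulHom α) a b c
    zero_mul := fun a => LinearMap.map_zero₂ (mulHom α) a
    mul_zero := fun a => map_zero (mulHom α a)
    mul_assoc := mulHom_assoc α
    one_mul := mulHom_one_left α
    mul_one := mulHom_one_right α }

instance : Algebra k (TwistedGroupAlgebra α) :=
  Algebra.ofModule (fun r a b => LinearMap.map_smul₂ (mulHom α) r a b)
    (fun r a b => map_smul (mulHom α a) r b)

/-- The basis element `x_s` as a unit of `k_α S`. -/
def xUnit (s : S) : (TwistedGroupAlgebra α)ˣ where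
  val := x α s
  inv := ((((α s s⁻¹)⁻¹ * (α 1 1)⁻¹ : kˣ)) : k) • x α s⁻¹
  val_inv := by
    rw [mul_smul_comm, x_mul_x, smul_smul, mul_inv_cancel, one_def, ← Units.val_mul]
    congr 2
    rw [mul_right_comm, inv_mul_cancel, one_mul]
  inv_val := by
    have h : α s s⁻¹ = α s⁻¹ s := by
      have := α.cocycle s s⁻¹ s
      simpa [α.map_one_left, α.map_one_right, mul_comm] using this
    rw [smul_mul_assoc, x_mul_x, smul_smul, inv_mul_cancel, one_def, ← Units.val_mul]
    congr 2
    rw [h, mul_right_comm, inv_mul_cancel, one_mul]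

theorem val_xUnit (s : S) : (xUnit α s : TwistedGroupAlgebra α) = x α s := rfl

/-- The left action `s ▷ a = x_s a x_s⁻¹` of `S` on `k_α S` by algebra automorphisms. -/
def act (s : S) (a : TwistedGroupAlgebra α) : TwistedGroupAlgebra α :=
  xUnit α s * a * ((xUnit α s)⁻¹ : (TwistedGroupAlgebra α)ˣ)

theorem x_ne_zero (s : S) : x α s ≠ 0 := (basis α).ne_zero s

theorem act_x (t s : S) :
    ∃ c : kˣ, act α t (x α s) = (c : k) • x α (t * s * t⁻¹) := by
  refine ⟨α t s * (α (t * s * t⁻¹) t)⁻¹, ?_⟩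
  rw [act, Units.mul_inv_eq_iff_eq_mul]
  simp only [val_xUnit, smul_mul_assoc, x_mul_x, smul_smul, inv_mul_cancel_right]
  rw [← Units.val_mul, inv_mul_cancel_right]

theorem act_mul (s : S) (a b : TwistedGroupAlgebra α) :
    act α s (a * b) = act α s a * act α s b := by
  simp only [act, mul_assoc, Units.inv_mul_cancel_left]

/-- For commuting `s`, `t`, the condition `α(s,t) = α(t,s)` says that `x_s` and `x_t` commute. -/
theorem eq_iff_commute {s t : S} (h : Commute s t) :
    α s t = α t s ↔ Commute (x α s) (x α t) := by
  rw [Commute, SemiconjBy, x_mul_x, x_mul_x, h.eq]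
  constructor
  · intro e; rw [e]
  · intro e
    exact Units.ext (smul_left_injective k (x_ne_zero α (t * s)) e)

end TwistedGroupAlgebra

section GaloisObject

variable {G : Type*} [Group G] {k : Type*} [Field k]

/-- The algebra `A(G,S,α)` of functions `f : G → k_α S` with `f (s g) = s ▷ f g`
for all `s ∈ S`, `g ∈ G`, with pointwise operations. -/
def galoisAlgebra (S : Subgroup G) (α : TwoCocycle S k) :
    Subalgebra k (G → TwistedGroupAlgebra α) where
  carrier := {f | ∀ (s : S) (g : G), f (s * g) = TwistedGroupAlgebra.act α s (f g)}
  mul_mem' := by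
    intro a b ha hb s g
    simp only [Pi.mul_apply, ha s g, hb s g, TwistedGroupAlgebra.act_mul]
  add_mem' := by
    intro a b ha hb s g
    simp only [Pi.add_apply, ha s g, hb s g, TwistedGroupAlgebra.act, mul_add, add_mul]
  algebraMap_mem' := by
    intro r s g
    simp only [Pi.algebraMap_apply, TwistedGroupAlgebra.act]
    rw [← Algebra.commutes r, mul_assoc, Units.mul_inv, mul_one]

/-- The action `(g • f) h = f (h g)` of `G` on `A(G,S,α)` by algebra automorphisms. -/
instance (S : Subgroup G) (α : TwoCocycle S k) : MulSemiringAction G (galoisAlgebra S α) where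
  smul g f := ⟨fun h => f.1 (h * g), fun s h => by
    change f.1 (s * h * g) = _
    rw [mul_assoc]; exact f.2 s (h * g)⟩
  one_smul f := Subtype.ext (funext fun h => congrArg f.1 (mul_one h))
  mul_smul g g' f := Subtype.ext (funext fun h => congrArg f.1 (mul_assoc h g g').symm)
  smul_zero _ := rfl
  smul_add _ _ _ := rfl
  smul_one _ := rfl
  smul_mul _ _ _ := rfl

theorem galoisAlgebra_smul_apply {S : Subgroup G} {α : TwoCocycle S k} (g : G)
    (f : galoisAlgebra S α) (h : G) : (g • f).1 h = f.1 (h * g) := rfl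

instance (S : Subgroup G) (α : TwoCocycle S k) : SMulCommClass G k (galoisAlgebra S α) :=
  ⟨fun _ _ _ => rfl⟩

end GaloisObject

section HopfGalois

/-! For a `G`-module algebra `A`, regarded as a right comodule algebra over the Hopf algebra
`k^G` of functions `G → k`. -/

variable (k G : Type*) [Field k] [Group G] [Fintype G] [DecidableEq G]
  {A : Type*} [Ring A] [Algebra k A] [MulSemiringAction G A] [SMulCommClass G k A]

/-- The coaction `ρ(a) = ∑ g, g • a ⊗ e_g`, where `e_g ∈ k^G` is the indicator function of `g`. -/
def coaction : A →ₗ[k] A ⊗[k] (G → k) :=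
  ∑ g : G, (TensorProduct.mk k A (G → k)).flip (Pi.single g 1) ∘ₗ
    DistribSMul.toLinearMap k A g

variable (A) in
/-- The canonical map `can (x ⊗ y) = x y₍₀₎ ⊗ y₍₁₎`, i.e. `(x ⊗ 1) ρ(y)`. -/
def canonicalMap : A ⊗[k] A →ₗ[k] A ⊗[k] (G → k) :=
  LinearMap.mul' k (A ⊗[k] (G → k)) ∘ₗ
    TensorProduct.map (Algebra.TensorProduct.includeLeft (R := k) (S := k)).toLinearMap
      (coaction k G)

theorem coaction_apply (a : A) :
    coaction k G a = ∑ g : G, (g • a) ⊗ₜ[k] (Pi.single g (1 : k) : G → k) := by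
  simp [coaction]

theorem canonicalMap_tmul (a b : A) :
    canonicalMap k G A (a ⊗ₜ b) =
      ∑ g : G, (a * g • b) ⊗ₜ[k] (Pi.single g (1 : k) : G → k) := by
  simp [canonicalMap, coaction_apply, Finset.mul_sum]

variable (A) in
/-- `A` is a right `k^G`-Galois object: its algebra of coinvariants is the base field, and the
canonical map is bijective. -/
structure IsGaloisObject : Prop where
  coinvariants : ∀ a : A, coaction k G a = a ⊗ₜ 1 ↔ a ∈ (⊥ : Subalgebra k A)
  bijective : Function.Bijective (canonicalMap k G A)

variable {k G}

/-- The element `h^[1] ⊗ h^[2]` of `A ⊗ A` determined by `can (h^[1] ⊗ h^[2]) = 1 ⊗ h`. -/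
def IsGaloisObject.translation (hA : IsGaloisObject k G A) (h : G → k) : A ⊗[k] A :=
  (LinearEquiv.ofBijective (canonicalMap k G A) hA.bijective).symm (1 ⊗ₜ h)

/-- The Miyashita-Ulbrich action `a ↼ h = h^[1] a h^[2]` of `k^G` on a Galois object. -/
def IsGaloisObject.miyashitaUlbrich (hA : IsGaloisObject k G A) (a : A) (h : G → k) : A :=
  TensorProduct.lift (LinearMap.mul k A ∘ₗ LinearMap.mulRight k a) (hA.translation h)

/-- The subspace `B` is a `k^G`-submodule of `A` for the Miyashita-Ulbrich action. -/
def IsGaloisObject.IsMUSubmodule (hA : IsGaloisObject k G A) (B : Submodule k A) : Prop :=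
  ∀ a ∈ B, ∀ h : G → k, hA.miyashitaUlbrich a h ∈ B

end HopfGalois

section FiberProduct

variable {G : Type*} [Group G]

/-- The relation on `G × S` with `(g, s) ∼ (g t⁻¹, t s t⁻¹)` for `t ∈ S`. -/
def balancedSetoid (S : Subgroup G) : Setoid (G × S) where
  r p q := ∃ t : S, q = (p.1 * (t : G)⁻¹, t * p.2 * t⁻¹)
  iseqv :=
    { refl := fun p => ⟨1, by simp⟩
      symm := by
        rintro p q ⟨t, rfl⟩
        exact ⟨t⁻¹, by simp [mul_assoc]⟩
      trans := by
        rintro p q r ⟨t, rfl⟩ ⟨u, rfl⟩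
        exact ⟨u * t, by simp [mul_assoc]⟩ }

/-- The set `G ×_S S` of classes `(g, s)`. -/
def BalancedProduct (S : Subgroup G) : Type _ := Quotient (balancedSetoid S)

/-- The class of `(g, s)` in `G ×_S S`. -/
def BalancedProduct.mk {S : Subgroup G} (g : G) (s : S) : BalancedProduct S :=
  Quotient.mk (balancedSetoid S) (g, s)

/-- The subgroup `g⁻¹ F g`. -/
def conjInv (g : G) (F : Subgroup G) : Subgroup G := F.map (MulAut.conj g⁻¹).toMonoidHom

theorem mem_conjInv {g r : G} {F : Subgroup G} : r ∈ conjInv g F ↔ g * r * g⁻¹ ∈ F := by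
  simp only [conjInv, Subgroup.mem_map, MulEquiv.coe_toMonoidHom, MulAut.conj_apply, inv_inv]
  constructor
  · rintro ⟨f, hf, rfl⟩
    simpa [mul_assoc] using hf
  · intro h
    exact ⟨_, h, by simp [mul_assoc]⟩

variable {k : Type*} [Field k]

/-- The pair `(g, s)` is `(α,F)`-regular: `α(s,t) = α(t,s)` for all `t ∈ C_S(s) ∩ g⁻¹ F g`. -/
def IsRegularPair {S : Subgroup G} (α : TwoCocycle S k) (F : Subgroup G) (p : G × S) : Prop :=
  ∀ t ∈ Subgroup.centralizer {p.2}, (t : G) ∈ conjInv p.1 F → α p.2 t = α t p.2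

theorem IsRegularPair.move {S : Subgroup G} {α : TwoCocycle S k} {F : Subgroup G}
    {p q : G × S} (hpq : (balancedSetoid S).r p q) (hp : IsRegularPair α F p) :
    IsRegularPair α F q := by
  obtain ⟨t, rfl⟩ := hpq
  obtain ⟨g, s⟩ := p
  intro r hr hrF
  simp only at hr hrF ⊢
  obtain ⟨r', rfl⟩ : ∃ r', r = t * r' * t⁻¹ := ⟨t⁻¹ * r * t, by group⟩
  have hc : Commute s r' := by
    have h := Subgroup.mem_centralizer_singleton_iff.1 hr
    have h' : t * (r' * s) * t⁻¹ = t * (s * r') * t⁻¹ := by simpa [mul_assoc] using h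
    exact (mul_left_cancel (mul_right_cancel h')).symm
  have hreg := hp r' (Subgroup.mem_centralizer_singleton_iff.2 hc.eq.symm)
    (by rw [mem_conjInv] at hrF ⊢; simpa [mul_assoc] using hrF)
  rw [TwistedGroupAlgebra.eq_iff_commute α hc] at hreg
  rw [TwistedGroupAlgebra.eq_iff_commute α (by simpa [Commute, SemiconjBy] using hc)]
  obtain ⟨c, hc⟩ := TwistedGroupAlgebra.act_x α t s
  obtain ⟨d, hd⟩ := TwistedGroupAlgebra.act_x α t r'
  have h : Commute ((c : k) • TwistedGroupAlgebra.x α (t * s * t⁻¹))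
      ((d : k) • TwistedGroupAlgebra.x α (t * r' * t⁻¹)) := by
    rw [← hc, ← hd, Commute, SemiconjBy, ← TwistedGroupAlgebra.act_mul,
      ← TwistedGroupAlgebra.act_mul, hreg.eq]
  have h' := (h.smul_left ((c : k)⁻¹)).smul_right ((d : k)⁻¹)
  simpa [smul_smul] using h'

/-- The class `(g, s) ∈ G ×_S S` is `(α,F)`-regular; this depends only on the class. -/
def IsRegularClass {S : Subgroup G} (α : TwoCocycle S k) (F : Subgroup G) :
    BalancedProduct S → Prop :=
  Quotient.lift (IsRegularPair α F) fun _ _ h =>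
    propext ⟨IsRegularPair.move h, IsRegularPair.move ((balancedSetoid S).symm h)⟩

end FiberProduct

end

/-! Non-degeneracy of `α` makes `|S|` invertible in `k` and forces the norm `a ↦ ∑ s, s ▷ a` to be
`|S|` times the projection of `k_α S` onto `k x₁`. Consequently the functions supported on one coset
`S q` with values `x_s` and `x_s⁻¹` at `q` form, suitably scaled, Galois coordinates for the action
of `G` on `A(G,S,α)`. They invert the canonical map, and they compute the Miyashita-Ulbrich action:
`(a ↼ h)(q)` is `a(q)` with the coefficient of each `x_s` multiplied by `h (q⁻¹ s q)`.

Hence `a ↼ h` is `F`-invariant for all `h`, for a given `F`-invariant `a`, exactly when every `s`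
such that `x_s` occurs in some value `a(q)` commutes with `q F q⁻¹`. Finally, `x_s` occurs at `q` in
some `F`-invariant `a` exactly when `(q⁻¹, s)` is `(α,F)`-regular: `a(q)` is fixed by
`S ∩ q F q⁻¹`, and conversely the sum of the `F`-translates of the function supported on `S q` with
value `x_s` at `q` has as its `x_s`-coefficient at `q` the order of a subgroup of `S`.
-/

noncomputable section

namespace TwistedGroupAlgebra

variable {S k : Type*} [Group S] [Field k] {α : TwoCocycle S k}

/-- The coefficient of `x_s` in an element of `k_α S`. -/
abbrev coeff (s : S) : TwistedGroupAlgebra α →ₗ[k] k := (basis α).coord s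

theorem ext_coeff {a b : TwistedGroupAlgebra α} (h : ∀ s, coeff s a = coeff s b) : a = b :=
  (basis α).ext_elem h

theorem coeff_x [DecidableEq S] (s t : S) : coeff s (x α t) = if t = s then 1 else 0 := by
  rw [x, Module.Basis.coord_apply, Module.Basis.repr_self, Finsupp.single_apply]

theorem x_one : x α 1 = (α 1 1 : k) • (1 : TwistedGroupAlgebra α) := by
  rw [one_def, smul_smul, Units.mul_inv, one_smul]

theorem coeff_one_of_ne {s : S} (hs : s ≠ 1) :
    coeff s (1 : TwistedGroupAlgebra α) = 0 := by
  classical rw [one_def, map_smul, coeff_x, if_neg hs.symm, smul_zero]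

theorem coeff_x_mul (s t : S) (a : TwistedGroupAlgebra α) :
    coeff (s * t) (x α s * a) = α s t * coeff t a := by
  classical
  induction a using TwistedGroupAlgebra.induction with
  | h0 => simp only [mul_zero, map_zero]
  | hadd a b ha hb => simp only [mul_add, map_add, ha, hb]
  | hx c r =>
    rw [mul_smul_comm, x_mul_x]
    simp only [map_smul, coeff_x, mul_right_inj, smul_eq_mul]
    split_ifs with h
    · rw [h]; ring
    · simp only [mul_zero]

theorem coeff_mul_x (s t : S) (a : TwistedGroupAlgebra α) :
    coeff (s * t) (a * x α t) = α s t * coeff s a := by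
  classical
  induction a using TwistedGroupAlgebra.induction with
  | h0 => simp only [zero_mul, map_zero, mul_zero]
  | hadd a b ha hb => simp only [add_mul, map_add, ha, hb, mul_add]
  | hx c r =>
    rw [smul_mul_assoc, x_mul_x]
    simp only [map_smul, coeff_x, mul_left_inj, smul_eq_mul]
    split_ifs with h
    · rw [h]; ring
    · simp only [mul_zero]

theorem act_mul_x (s : S) (a : TwistedGroupAlgebra α) : act α s a * x α s = x α s * a := by
  rw [← val_xUnit, act, Units.inv_mul_cancel_right]

theorem act_eq_iff {s : S} {a b : TwistedGroupAlgebra α} :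
    act α s a = b ↔ x α s * a = b * x α s := by
  rw [act, Units.mul_inv_eq_iff_eq_mul, val_xUnit]

theorem one_act (a : TwistedGroupAlgebra α) : act α 1 a = a := by
  rw [act_eq_iff, x_one, smul_mul_assoc, mul_smul_comm, one_mul, mul_one]

theorem mul_act (s t : S) (a : TwistedGroupAlgebra α) :
    act α (s * t) a = act α s (act α t a) := by
  have hx : x α (s * t) = ((α s t)⁻¹ : kˣ) • (x α s * x α t) := by
    rw [x_mul_x, Units.smul_def, smul_smul, Units.inv_mul, one_smul]
  rw [act_eq_iff, hx, smul_mul_assoc, mul_smul_comm, ← mul_assoc (act α s _), act_mul_x,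
    mul_assoc (x α s) (act α t a), act_mul_x, mul_assoc]

variable (α) in
/-- The action `s ▷ a = x_s a x_s⁻¹` as a linear representation of `S` on `k_α S`. -/
def conjRep : Representation k S (TwistedGroupAlgebra α) where
  toFun s :=
    { toFun := act α s
      map_add' := by simp only [act, mul_add, add_mul, forall_const]
      map_smul' := by
        simp only [act, mul_smul_comm, smul_mul_assoc, RingHom.id_apply, forall_const] }
  map_one' := by ext1 a; exact one_act a
  map_mul' s t := by ext1 a; exact mul_act s t a

theorem conjRep_apply (s : S) (a : TwistedGroupAlgebra α) : conjRep α s a = act α s a := rfl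

theorem coeff_act (s t : S) (a : TwistedGroupAlgebra α) :
    coeff (t * s * t⁻¹) (act α t a) = (α t s / α (t * s * t⁻¹) t : kˣ) * coeff s a := by
  have h := congrArg (coeff (t * s)) (act_mul_x t a)
  rw [coeff_x_mul] at h
  nth_rw 1 [← inv_mul_cancel_right (t * s) t] at h
  rw [coeff_mul_x, mul_comm] at h
  rw [Units.val_div_eq_div_val, div_mul_eq_mul_div, eq_div_iff (Units.ne_zero _), h]

theorem coeff_act_of_commute {s t : S} (h : Commute s t) (a : TwistedGroupAlgebra α) :
    coeff s (act α t a) = (α t s / α s t : kˣ) * coeff s a := by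
  have hconj : t * s * t⁻¹ = s := by rw [← h.eq, mul_inv_cancel_right]
  simpa only [hconj] using coeff_act s t a

theorem eq_of_coeff_act_eq {s t : S} (h : Commute s t) {a : TwistedGroupAlgebra α}
    (ha : coeff s (act α t a) = coeff s a) (hs : coeff s a ≠ 0) : α s t = α t s := by
  rw [coeff_act_of_commute h, mul_eq_right₀ hs, Units.val_eq_one, div_eq_one] at ha
  exact ha.symm

theorem coeff_eq_zero_of_forall_act_eq (hα : α.IsNondegenerate) {a : TwistedGroupAlgebra α}
    (ha : ∀ t, act α t a = a) {s : S} (hs : s ≠ 1) : coeff s a = 0 := by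
  by_contra hsa
  refine hs <| (hα s).1 fun t ht => ?_
  have hst : Commute s t := (Subgroup.mem_centralizer_singleton_iff.1 ht).symm
  exact eq_of_coeff_act_eq hst (congrArg (coeff s) (ha t)) hsa

theorem eq_coeff_one_smul_x_one (hα : α.IsNondegenerate) {a : TwistedGroupAlgebra α}
    (ha : ∀ t, act α t a = a) : a = coeff 1 a • x α 1 := by
  classical
  refine ext_coeff fun s => ?_
  rw [map_smul, coeff_x, smul_eq_mul]
  split_ifs with hs
  · rw [mul_one, hs]
  · rw [mul_zero, coeff_eq_zero_of_forall_act_eq hα ha (Ne.symm hs)]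

theorem mem_bot_of_forall_act_eq (hα : α.IsNondegenerate) {a : TwistedGroupAlgebra α}
    (ha : ∀ t, act α t a = a) : a ∈ (⊥ : Subalgebra k (TwistedGroupAlgebra α)) := by
  rw [eq_coeff_one_smul_x_one hα ha, x_one]
  exact Subalgebra.smul_mem _ (Subalgebra.smul_mem _ (one_mem _) _) _

theorem norm_conjRep [Fintype S] (hα : α.IsNondegenerate) (a : TwistedGroupAlgebra α) :
    (conjRep α).norm a = ((Nat.card S : k) * coeff 1 a) • x α 1 := by
  have hfix (t : S) : act α t ((conjRep α).norm a) = (conjRep α).norm a := by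
    rw [← conjRep_apply, Representation.self_norm_apply]
  rw [eq_coeff_one_smul_x_one hα hfix]
  congr 1
  have hcoeff (t : S) : coeff 1 (act α t a) = coeff 1 a := by
    rw [coeff_act_of_commute (Commute.one_left t), α.map_one_left, α.map_one_right, div_self',
      Units.val_one, one_mul]
  simp only [Representation.norm, LinearMap.sum_apply, map_sum, conjRep_apply, hcoeff,
    Finset.sum_const, Finset.card_univ, nsmul_eq_mul, Nat.card_eq_fintype_card]

theorem sum_act_x_mul_mul_inv [Fintype S] (hα : α.IsNondegenerate) (u : S)
    (a : TwistedGroupAlgebra α) :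
    ∑ r : S, act α u (x α r) * a * ((xUnit α r)⁻¹ : (TwistedGroupAlgebra α)ˣ) =
      ((Nat.card S : k) * coeff u a) • x α u := by
  obtain ⟨b, rfl⟩ : ∃ b, x α u * b = a := ⟨_, (xUnit α u).mul_inv_cancel_left a⟩
  have hnorm : ∑ r : S, act α u (x α r) * (x α u * b) * ((xUnit α r)⁻¹ : (TwistedGroupAlgebra α)ˣ) =
      x α u * (conjRep α).norm b := by
    simp only [Representation.norm, LinearMap.sum_apply, Finset.mul_sum, conjRep_apply]
    refine Finset.sum_congr rfl fun r _ => ?_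
    rw [← mul_assoc (act α u _), act_mul_x, act, val_xUnit]
    simp only [mul_assoc]
  have hcoeff : coeff u (x α u * b) = α u 1 * coeff 1 b := by
    simpa only [mul_one] using coeff_x_mul u 1 b
  rw [hnorm, norm_conjRep hα, mul_smul_comm, x_mul_x, mul_one, smul_smul, hcoeff, mul_assoc,
    mul_comm (coeff 1 b)]

theorem exists_x_pow_eq (s : S) (n : ℕ) : ∃ c : kˣ, x α s ^ n = c • x α (s ^ n) := by
  induction n with
  | zero => exact ⟨(α 1 1)⁻¹, by rw [pow_zero, pow_zero]; rfl⟩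
  | succ n ih =>
    obtain ⟨c, hc⟩ := ih
    exact ⟨c * α (s ^ n) s, by rw [pow_succ, hc, smul_mul_assoc, x_mul_x, pow_succ, mul_smul]; rfl⟩

theorem act_x_of_commute {s t : S} (h : Commute s t) :
    act α t (x α s) = (α t s / α s t : kˣ) • x α s := by
  rw [act_eq_iff, smul_mul_assoc, x_mul_x, x_mul_x, h.eq, Units.smul_def, smul_smul,
    ← Units.val_mul, div_mul_cancel]

theorem div_pow_orderOf_eq_one {s t : S} (h : Commute s t) :
    (α t s / α s t) ^ orderOf s = 1 := by
  set ζ := α t s / α s t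
  obtain ⟨c, hc⟩ := exists_x_pow_eq (α := α) s (orderOf s)
  rw [pow_orderOf_eq_one] at hc
  have hfix : act α t (x α s ^ orderOf s) = x α s ^ orderOf s := by
    rw [hc, x_one, act, Units.smul_def, smul_smul, mul_smul_comm, mul_one, smul_mul_assoc,
      Units.mul_inv]
  have hscale : act α t (x α s ^ orderOf s) = ζ ^ orderOf s • x α s ^ orderOf s := by
    rw [← smul_pow, ← act_x_of_commute h, act, act, Units.conj_pow]
  have hne : x α s ^ orderOf s ≠ 0 := by
    rw [hc]; exact (smul_ne_zero_iff_ne c).2 (x_ne_zero α 1)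
  refine Units.ext <| smul_left_injective k hne ?_
  simpa only [Units.val_one, one_smul, hfix, Units.smul_def] using hscale.symm

theorem natCast_card_ne_zero [Finite S] (hα : α.IsNondegenerate) : (Nat.card S : k) ≠ 0 := by
  obtain ⟨p, _⟩ := CharP.exists k
  rw [Ne, CharP.cast_eq_zero_iff k p]
  intro hdvd
  have hp : p.Prime := (CharP.char_is_prime_or_zero k p).resolve_right <| by
    rintro rfl
    exact Nat.card_pos.ne' (zero_dvd_iff.1 hdvd)
  have := Fact.mk hp
  obtain ⟨s, hs⟩ := exists_prime_orderOf_dvd_card' p hdvd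
  refine hp.ne_one <| hs.symm.trans <| orderOf_eq_one_iff.2 <| (hα s).1 fun t ht => ?_
  have hst : Commute s t := (Subgroup.mem_centralizer_singleton_iff.1 ht).symm
  have hζ : ((α t s / α s t : kˣ) : k) ^ p = 1 := by
    rw [← Units.val_pow_eq_pow_val, ← hs, div_pow_orderOf_eq_one hst, Units.val_one]
  have hζ_one : ((α t s / α s t : kˣ) : k) = 1 :=
    frobenius_inj k p <| by rw [frobenius_def, hζ, map_one]
  exact (div_eq_one.1 (Units.val_eq_one.1 hζ_one)).symm

end TwistedGroupAlgebra

section TensorComponent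

variable {k G A : Type*} [Field k] [Ring A] [Algebra k A]

/-- The component `a_g` of `∑ g, a_g ⊗ e_g ∈ A ⊗ k^G`. -/
def tensorComponent (g : G) : A ⊗[k] (G → k) →ₗ[k] A :=
  TensorProduct.rid k A ∘ₗ (LinearMap.proj g).lTensor A

theorem tensorComponent_tmul (g : G) (a : A) (h : G → k) :
    tensorComponent g (a ⊗ₜ[k] h) = h g • a := by
  simp only [tensorComponent, LinearMap.comp_apply, LinearMap.lTensor_tmul, LinearMap.proj_apply,
    LinearEquiv.coe_coe, TensorProduct.rid_tmul]

variable [Fintype G] [DecidableEq G]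

theorem tensorComponent_sum_tmul_single (a : G → A) (g : G) :
    tensorComponent g (∑ h, a h ⊗ₜ[k] (Pi.single h 1 : G → k)) = a g := by
  simp only [map_sum, tensorComponent_tmul, Pi.single_apply, ite_smul, one_smul, zero_smul,
    Finset.sum_ite_eq, Finset.mem_univ, if_true]

theorem sum_smul_tmul_single (a : A) (h : G → k) :
    ∑ g, h g • a ⊗ₜ[k] (Pi.single g 1 : G → k) = a ⊗ₜ h := by
  simp only [← TensorProduct.tmul_smul, ← TensorProduct.tmul_sum]
  congr 1
  simpa only [← Pi.single_smul, smul_eq_mul, mul_one] using Finset.univ_sum_single h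

variable [Group G] [MulSemiringAction G A] [SMulCommClass G k A]

theorem tensorComponent_canonicalMap_tmul (g : G) (x y : A) :
    tensorComponent g (canonicalMap k G A (x ⊗ₜ y)) = x * g • y := by
  rw [canonicalMap_tmul, tensorComponent_sum_tmul_single]

theorem coaction_eq_tmul_one_iff {a : A} : coaction k G a = a ⊗ₜ 1 ↔ ∀ g : G, g • a = a := by
  rw [coaction_apply]
  refine ⟨fun h g => ?_, fun h => ?_⟩
  · simpa only [tensorComponent_sum_tmul_single, tensorComponent_tmul, Pi.one_apply, one_smul]
      using congrArg (tensorComponent g) h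
  · simpa only [h, Pi.one_apply, one_smul] using sum_smul_tmul_single a (1 : G → k)

end TensorComponent

/-- Galois coordinates, in the sense of Chase, Harrison and Rosenberg, for an action of `G`
on `A`: by `IsGaloisSystem.canonicalMap_sum`, they exhibit `1 ⊗ e_g` as the image of
`∑ i, g • u i ⊗ v i` under the canonical map. -/
def IsGaloisSystem (G : Type*) {A ι : Type*} [Group G] [DecidableEq G] [Ring A]
    [MulSemiringAction G A] [Fintype ι] (u v : ι → A) : Prop :=
  ∀ g : G, ∑ i, g • u i * v i = if g = 1 then 1 else 0

namespace IsGaloisSystem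

variable {G A ι : Type*} [Group G] [DecidableEq G] [Ring A] [MulSemiringAction G A] [Fintype ι]
  {u v : ι → A}

theorem sum_smul_mul_smul (huv : IsGaloisSystem G u v) (g h : G) :
    ∑ i, g • u i * h • v i = if h = g then 1 else 0 := by
  have hsum : ∑ i, g • u i * h • v i = h • ∑ i, (h⁻¹ * g) • u i * v i := by
    simp only [Finset.smul_sum, smul_mul', mul_smul, smul_inv_smul]
  rw [hsum, huv, smul_ite, smul_one, smul_zero]
  simp only [inv_mul_eq_one]

variable {k : Type*} [Field k] [Algebra k A] [Fintype G]

theorem eq_sum_trace_mul (huv : IsGaloisSystem G u v) (a : A) :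
    a = ∑ i, (∑ g : G, g • (a * u i)) * v i := by
  simp only [smul_mul', Finset.sum_mul]
  rw [Finset.sum_comm]
  simp only [mul_assoc, ← Finset.mul_sum, huv _, mul_ite, mul_one, mul_zero,
    Finset.sum_ite_eq', Finset.mem_univ, if_true, one_smul]

theorem tmul_eq_sum (huv : IsGaloisSystem G u v)
    (hfix : ∀ a : A, (∀ g : G, g • a = a) → a ∈ (⊥ : Subalgebra k A)) (x y : A) :
    x ⊗ₜ[k] y = ∑ i, (∑ g : G, x * g • y * g • u i) ⊗ₜ[k] v i := by
  have htrace (a : A) : ∑ g : G, g • a ∈ (⊥ : Subalgebra k A) := by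
    refine hfix _ fun h => ?_
    simp only [Finset.smul_sum, ← mul_smul]
    exact Fintype.sum_equiv (Equiv.mulLeft h) _ _ fun _ => rfl
  choose c hc using fun i => Algebra.mem_bot.1 (htrace (y * u i))
  conv_lhs => rw [huv.eq_sum_trace_mul y]
  simp only [mul_assoc, ← smul_mul', ← Finset.mul_sum, ← hc, TensorProduct.tmul_sum]
  refine Finset.sum_congr rfl fun i _ => ?_
  rw [← Algebra.smul_def, ← Algebra.commutes, ← Algebra.smul_def, TensorProduct.smul_tmul]

variable [SMulCommClass G k A]

theorem canonicalMap_sum (huv : IsGaloisSystem G u v) (a : A) (g : G) :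
    canonicalMap k G A (∑ i, (a * g • u i) ⊗ₜ v i) = a ⊗ₜ Pi.single g 1 := by
  simp only [map_sum, canonicalMap_tmul, mul_assoc]
  rw [Finset.sum_comm]
  simp only [← TensorProduct.sum_tmul, ← Finset.mul_sum, huv.sum_smul_mul_smul, mul_ite, mul_one,
    mul_zero, TensorProduct.ite_tmul, Finset.sum_ite_eq', Finset.mem_univ, if_true]

theorem canonicalMap_surjective (huv : IsGaloisSystem G u v) :
    Function.Surjective (canonicalMap k G A) := by
  rw [← LinearMap.range_eq_top, eq_top_iff, ← TensorProduct.span_tmul_eq_top, Submodule.span_le]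
  rintro _ ⟨a, h, rfl⟩
  rw [← sum_smul_tmul_single]
  exact Submodule.sum_mem _ fun g _ => Submodule.smul_mem _ _ ⟨_, huv.canonicalMap_sum a g⟩

theorem canonicalMap_injective (huv : IsGaloisSystem G u v)
    (hfix : ∀ a : A, (∀ g : G, g • a = a) → a ∈ (⊥ : Subalgebra k A)) :
    Function.Injective (canonicalMap k G A) := by
  let inv : A ⊗[k] (G → k) →ₗ[k] A ⊗[k] A := ∑ i, (TensorProduct.mk k A A).flip (v i) ∘ₗ
    ∑ g : G, LinearMap.mulRight k (g • u i) ∘ₗ tensorComponent g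
  have hinv : inv ∘ₗ canonicalMap k G A = LinearMap.id := by
    ext x y
    simp only [inv, TensorProduct.AlgebraTensorModule.curry_apply, TensorProduct.curry_apply,
      LinearMap.coe_restrictScalars, LinearMap.comp_apply, LinearMap.sum_apply,
      LinearMap.flip_apply, TensorProduct.mk_apply, LinearMap.mulRight_apply,
      tensorComponent_canonicalMap_tmul, LinearMap.id_apply]
    exact (huv.tmul_eq_sum hfix x y).symm
  exact Function.LeftInverse.injective (LinearMap.congr_fun hinv)

theorem isGaloisObject (huv : IsGaloisSystem G u v)
    (hfix : ∀ a : A, (∀ g : G, g • a = a) → a ∈ (⊥ : Subalgebra k A)) : IsGaloisObject k G A where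
  coinvariants a := by
    refine coaction_eq_tmul_one_iff.trans ⟨hfix a, ?_⟩
    rintro ⟨c, rfl⟩ g
    exact smul_algebraMap g c
  bijective := ⟨huv.canonicalMap_injective hfix, huv.canonicalMap_surjective⟩

theorem miyashitaUlbrich_eq (huv : IsGaloisSystem G u v) (hA : IsGaloisObject k G A) (a : A)
    (h : G → k) : hA.miyashitaUlbrich a h = ∑ g, h g • ∑ i, g • u i * a * v i := by
  have hcan (g : G) :
      canonicalMap k G A (∑ i, (g • u i) ⊗ₜ v i) = 1 ⊗ₜ Pi.single g 1 := by
    simpa only [one_mul] using huv.canonicalMap_sum (k := k) 1 g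
  have htranslation : hA.translation h = ∑ g, h g • ∑ i, (g • u i) ⊗ₜ[k] v i := by
    rw [IsGaloisObject.translation, LinearEquiv.symm_apply_eq, LinearEquiv.ofBijective_apply,
      map_sum, ← sum_smul_tmul_single]
    simp only [map_smul, hcan]
  rw [IsGaloisObject.miyashitaUlbrich, htranslation]
  simp only [map_sum, map_smul, TensorProduct.lift.tmul, LinearMap.comp_apply,
    LinearMap.mulRight_apply, LinearMap.mul_apply']

end IsGaloisSystem

namespace galoisAlgebra

open TwistedGroupAlgebra

variable {G k : Type*} [Group G] [Field k] {S : Subgroup G} {α : TwoCocycle S k}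

/-- Evaluation at `q` as an algebra homomorphism. -/
def ev (q : G) : galoisAlgebra S α →ₐ[k] TwistedGroupAlgebra α :=
  (Pi.evalAlgHom k _ q).comp (galoisAlgebra S α).val

theorem ev_smul (q g : G) (a : galoisAlgebra S α) : ev q (g • a) = ev (q * g) a := rfl

theorem ev_mul_left (s : S) (q : G) (a : galoisAlgebra S α) :
    ev (s * q) a = act α s (ev q a) := a.2 s q

theorem ext_ev {a b : galoisAlgebra S α} (h : ∀ q, ev q a = ev q b) : a = b :=
  Subtype.ext (funext h)

theorem mem_bot_of_forall_smul_eq (hα : α.IsNondegenerate) {a : galoisAlgebra S α}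
    (ha : ∀ g : G, g • a = a) : a ∈ (⊥ : Subalgebra k (galoisAlgebra S α)) := by
  have hconst (q : G) : ev q a = ev 1 a := by
    conv_rhs => rw [← ha q, ev_smul, one_mul]
  have hact (s : S) : act α s (ev 1 a) = ev 1 a := by rw [← ev_mul_left, hconst]
  obtain ⟨c, hc⟩ := Algebra.mem_bot.1 (mem_bot_of_forall_act_eq hα hact)
  exact Algebra.mem_bot.2 ⟨c, ext_ev fun q => by rw [hconst, ← hc, AlgHom.commutes]⟩

theorem coeff_ev_mul_left_eq {a b : galoisAlgebra S α} {c : k} {q : G} {s : S}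
    (h : coeff s (ev q b) = c * coeff s (ev q a)) (t : S) :
    coeff (t * s * t⁻¹) (ev (t * q) b) = c * coeff (t * s * t⁻¹) (ev (t * q) a) := by
  simp only [ev_mul_left, coeff_act, h, mul_left_comm]

section DoubleCosetSum

variable [Fintype S]

open Classical in
/-- The sum of the translates under `F` of the function in `A(G,S,α)` which is supported on
`S q` and takes the value `v` at `q`; it is supported on the double coset `S q F`. -/
def doubleCosetSum (F : Subgroup G) (q : G) (v : TwistedGroupAlgebra α) : galoisAlgebra S α :=
  ⟨fun p => ∑ t : S, if q⁻¹ * (t : G)⁻¹ * p ∈ F then act α t v else 0, fun s p => by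
    change _ = conjRep α s _
    rw [map_sum]
    refine (Fintype.sum_equiv (Equiv.mulLeft s) _ _ fun t => ?_).symm
    simp only [Equiv.coe_mulLeft, Subgroup.coe_mul, mul_inv_rev, mul_assoc, inv_mul_cancel_left,
      apply_ite (conjRep α s), map_zero, conjRep_apply, mul_act]⟩

open Classical in
theorem ev_doubleCosetSum (F : Subgroup G) (p q : G) (v : TwistedGroupAlgebra α) :
    ev p (doubleCosetSum F q v) =
      ∑ t : S, if q⁻¹ * (t : G)⁻¹ * p ∈ F then act α t v else 0 := rfl

/-- The function in `A(G,S,α)` which is supported on `S q` and takes the value `v` at `q`. -/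
abbrev single (q : G) (v : TwistedGroupAlgebra α) : galoisAlgebra S α := doubleCosetSum ⊥ q v

theorem ev_single_mul_left (q : G) (v : TwistedGroupAlgebra α) (s : S) :
    ev (s * q) (single q v) = act α s v := by
  classical
  have hmem (t : S) : q⁻¹ * (t : G)⁻¹ * (s * q) ∈ (⊥ : Subgroup G) ↔ t = s := by
    rw [Subgroup.mem_bot, ← mul_inv_rev, inv_mul_eq_one, mul_left_inj, Subtype.coe_inj]
  simp only [ev_doubleCosetSum, hmem, Finset.sum_ite_eq', Finset.mem_univ, if_true]

theorem ev_single_of_notMem {p q : G} (h : p * q⁻¹ ∉ S) (v : TwistedGroupAlgebra α) :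
    ev p (single q v) = 0 := by
  refine Finset.sum_eq_zero fun t _ => if_neg fun ht => h ?_
  rw [Subgroup.mem_bot, ← mul_inv_rev, inv_mul_eq_one] at ht
  rw [← ht, mul_inv_cancel_right]
  exact t.2

end DoubleCosetSum

section GaloisSystem

variable [Fintype S] [DecidableEq G]

theorem coeff_ev_sum_single (hα : α.IsNondegenerate) (q g : G) (a : galoisAlgebra S α) (s : S) :
    coeff s (ev q (∑ r : S,
      g • single q (x α r) * a * single q ((xUnit α r)⁻¹ : (TwistedGroupAlgebra α)ˣ))) =
      (if (s : G) = q * g * q⁻¹ then (Nat.card S : k) else 0) * coeff s (ev q a) := by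
  have hright (v : TwistedGroupAlgebra α) : ev q (single q v) = v := by
    simpa only [Subgroup.coe_one, one_mul, one_act] using ev_single_mul_left q v 1
  simp only [map_sum (ev q), map_mul, ev_smul, hright]
  by_cases hu : q * g * q⁻¹ ∈ S
  · obtain ⟨u, hu⟩ : ∃ u : S, (u : G) = q * g * q⁻¹ := ⟨⟨_, hu⟩, rfl⟩
    have hqg : q * g = u * q := by rw [hu, inv_mul_cancel_right]
    simp only [hqg, ev_single_mul_left, mul_inv_cancel_right, Subtype.coe_inj,
      sum_act_x_mul_mul_inv hα, map_smul, coeff_x, smul_eq_mul]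
    split_ifs with h₁ h₂ h₂
    · rw [h₁, mul_one]
    · exact absurd h₁.symm h₂
    · exact absurd h₂.symm h₁
    · rw [mul_zero, zero_mul]
  · have hs : (s : G) ≠ q * g * q⁻¹ := fun h => hu (h ▸ s.2)
    simp only [ev_single_of_notMem hu, zero_mul, Finset.sum_const_zero, map_zero, if_neg hs]

theorem coeff_ev_sum_single_of_mul_inv_mem (hα : α.IsNondegenerate) {p q : G}
    (hpq : p * q⁻¹ ∈ S) (g : G) (a : galoisAlgebra S α) (s : S) :
    coeff s (ev p (∑ r : S,
      g • single q (x α r) * a * single q ((xUnit α r)⁻¹ : (TwistedGroupAlgebra α)ˣ))) =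
      (if (s : G) = p * g * p⁻¹ then (Nat.card S : k) else 0) * coeff s (ev p a) := by
  obtain ⟨t, rfl⟩ : ∃ t : S, t * q = p := ⟨⟨_, hpq⟩, inv_mul_cancel_right p q⟩
  obtain ⟨s, rfl⟩ : ∃ s', t * s' * t⁻¹ = s := ⟨t⁻¹ * s * t, by group⟩
  rw [coeff_ev_mul_left_eq (coeff_ev_sum_single hα q g a s) t]
  have hs : (s : G) = q * g * q⁻¹ ↔ ((t * s * t⁻¹ : S) : G) = t * q * g * (t * q)⁻¹ := by
    simp only [Subgroup.coe_mul, Subgroup.coe_inv, mul_inv_rev, ← mul_assoc, mul_left_inj]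
    simp only [mul_assoc, mul_right_inj]
  simp only [hs]

/-- The left half of the Galois system of `A(G,S,α)`. -/
def leftCoordinate (i : G × S) : galoisAlgebra S α := single i.1 (x α i.2)

/-- The right half of the Galois system of `A(G,S,α)`. One factor `|S|` normalizes the sum over
`S`, the other one compensates for summing over `G` rather than over the cosets `S q`. -/
def rightCoordinate (i : G × S) : galoisAlgebra S α :=
  ((Nat.card S : k) ^ 2)⁻¹ • single i.1 ((xUnit α i.2)⁻¹ : (TwistedGroupAlgebra α)ˣ)

variable [Fintype G]

theorem coeff_ev_sum_coordinates (hα : α.IsNondegenerate) (q g : G) (a : galoisAlgebra S α)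
    (s : S) :
    coeff s (ev q (∑ i, g • leftCoordinate i * a * rightCoordinate i)) =
      if (s : G) = q * g * q⁻¹ then coeff s (ev q a) else 0 := by
  classical
  have hcard : (Nat.card S : k) ≠ 0 := natCast_card_ne_zero hα
  set c : k := if (s : G) = q * g * q⁻¹ then Nat.card S else 0 with hc
  have hterm (t : G) : coeff s (ev q (∑ r : S,
      g • single t (x α r) * a * single t ((xUnit α r)⁻¹ : (TwistedGroupAlgebra α)ˣ))) =
      if q / t ∈ S then c * coeff s (ev q a) else 0 := by
    rw [div_eq_mul_inv]
    split_ifs with ht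
    · exact coeff_ev_sum_single_of_mul_inv_mem hα ht g a s
    · simp only [map_sum (ev q), map_mul, ev_single_of_notMem ht, mul_zero,
        Finset.sum_const_zero, map_zero]
  have hcount : ∑ t : G, (if q / t ∈ S then c * coeff s (ev q a) else 0) =
      Nat.card S * (c * coeff s (ev q a)) := by
    refine (Fintype.sum_equiv (Equiv.divLeft q) _
      (fun t => if t ∈ S then c * coeff s (ev q a) else 0) fun _ => rfl).trans ?_
    rw [← Finset.sum_filter, Finset.sum_const, nsmul_eq_mul, ← Fintype.card_subtype,
      ← Nat.card_eq_fintype_card]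
  simp only [leftCoordinate, rightCoordinate, mul_smul_comm, ← Finset.smul_sum,
    Fintype.sum_prod_type, map_smul, map_sum] at hterm ⊢
  rw [Fintype.sum_congr _ _ hterm, hcount, hc, smul_eq_mul]
  split_ifs
  · field_simp
  · simp only [zero_mul, mul_zero]

theorem isGaloisSystem (hα : α.IsNondegenerate) :
    IsGaloisSystem G (leftCoordinate (S := S) (α := α)) rightCoordinate := by
  intro g
  refine ext_ev fun q => ext_coeff fun s => ?_
  have h := coeff_ev_sum_coordinates hα q g 1 s
  rw [map_one] at h
  simp only [mul_one] at h
  rw [h]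
  by_cases hs : s = 1
  · have hg : (1 : G) = q * g * q⁻¹ ↔ g = 1 := by
      rw [eq_comm, mul_inv_eq_one, mul_eq_left]
    simp only [hs, Subgroup.coe_one, hg]
    split_ifs <;> simp only [map_one, map_zero]
  · have hg : coeff s (ev q (if g = 1 then (1 : galoisAlgebra S α) else 0)) = 0 := by
      split_ifs <;> simp only [map_one, map_zero, coeff_one_of_ne hs]
    rw [coeff_one_of_ne hs, ite_self, hg]

end GaloisSystem

section MiyashitaUlbrich

variable [Fintype G] [DecidableEq G]

theorem isGaloisObject (hα : α.IsNondegenerate) : IsGaloisObject k G (galoisAlgebra S α) :=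
  have := Fintype.ofFinite S
  (isGaloisSystem hα).isGaloisObject fun _ => mem_bot_of_forall_smul_eq hα

theorem coeff_ev_miyashitaUlbrich (hα : α.IsNondegenerate)
    (hA : IsGaloisObject k G (galoisAlgebra S α)) (a : galoisAlgebra S α) (h : G → k) (q : G)
    (s : S) :
    coeff s (ev q (hA.miyashitaUlbrich a h)) = h (q⁻¹ * s * q) * coeff s (ev q a) := by
  have := Fintype.ofFinite S
  have hs (g : G) : (s : G) = q * g * q⁻¹ ↔ g = q⁻¹ * s * q := by
    rw [eq_mul_inv_iff_mul_eq, mul_assoc, eq_inv_mul_iff_mul_eq, eq_comm]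
  rw [(isGaloisSystem hα).miyashitaUlbrich_eq hA, map_sum, map_sum]
  simp only [map_smul, coeff_ev_sum_coordinates hα, hs, smul_eq_mul, mul_ite, mul_zero,
    Finset.sum_ite_eq', Finset.mem_univ, if_true]

end MiyashitaUlbrich

section FixedPoints

theorem inv_conj_mul_eq_iff {q r s : G} :
    (r * q)⁻¹ * s * (r * q) = q⁻¹ * s * q ↔ r * s = s * r := by
  rw [mul_inv_rev, ← mul_assoc _ r q, mul_left_inj, mul_assoc, mul_assoc, mul_right_inj,
    inv_mul_eq_iff_eq_mul, eq_comm]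

variable {F : Subgroup G}

theorem mem_fixedPoints_iff {a : galoisAlgebra S α} :
    a ∈ FixedPoints.subalgebra k (galoisAlgebra S α) F ↔
      ∀ q, ∀ r ∈ conjInv q⁻¹ F, ev (r * q) a = ev q a := by
  simp only [mem_conjInv, inv_inv]
  refine ⟨fun ha q r hr => ?_, fun ha f => ext_ev fun q => ?_⟩
  · conv_rhs => rw [← ha ⟨_, hr⟩]
    rw [Subgroup.mk_smul, ev_smul]
    group
  · have hf : q⁻¹ * (q * f * q⁻¹) * q ∈ F := by
      simpa only [mul_assoc, inv_mul_cancel, inv_mul_cancel_left, mul_one] using f.2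
    have h := ha q _ hf
    rwa [inv_mul_cancel_right, ← ev_smul] at h

theorem isRegularPair_of_coeff_ne_zero {a : galoisAlgebra S α}
    (ha : a ∈ FixedPoints.subalgebra k (galoisAlgebra S α) F) {q : G} {s : S}
    (hs : coeff s (ev q a) ≠ 0) : IsRegularPair α F (q⁻¹, s) := by
  intro t ht htF
  have hst : Commute s t := (Subgroup.mem_centralizer_singleton_iff.1 ht).symm
  refine eq_of_coeff_act_eq hst (congrArg (coeff s) ?_) hs
  rw [← ev_mul_left, mem_fixedPoints_iff.1 ha q t htF]

theorem doubleCosetSum_mem_fixedPoints [Fintype S] (q : G) (v : TwistedGroupAlgebra α) :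
    doubleCosetSum F q v ∈ FixedPoints.subalgebra k (galoisAlgebra S α) F := by
  classical
  refine mem_fixedPoints_iff.2 fun p r hr => ?_
  have hmem (t : S) : q⁻¹ * (t : G)⁻¹ * (r * p) ∈ F ↔ q⁻¹ * (t : G)⁻¹ * p ∈ F := by
    have hfactor : q⁻¹ * (t : G)⁻¹ * (r * p) =
        q⁻¹ * (t : G)⁻¹ * p * (p⁻¹ * r * p⁻¹⁻¹) := by group
    rw [hfactor, F.mul_mem_cancel_right (mem_conjInv.1 hr)]
  simp only [ev_doubleCosetSum, hmem]

theorem coeff_ev_doubleCosetSum_x [Fintype S] {q : G} {s : S}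
    (hreg : IsRegularPair α F (q⁻¹, s)) :
    coeff s (ev q (doubleCosetSum F q (x α s))) =
      Nat.card (Subgroup.centralizer {s} ⊓ (conjInv q⁻¹ F).subgroupOf S : Subgroup S) := by
  classical
  have hmem (t : S) : q⁻¹ * (t : G)⁻¹ * q ∈ F ↔ (t : G) ∈ conjInv q⁻¹ F := by
    rw [mem_conjInv, ← F.inv_mem_iff]
    group
  have hterm (t : S) : coeff s (if q⁻¹ * (t : G)⁻¹ * q ∈ F then act α t (x α s) else 0) =
      if t ∈ Subgroup.centralizer {s} ⊓ (conjInv q⁻¹ F).subgroupOf S then 1 else 0 := by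
    simp only [hmem, Subgroup.mem_inf, Subgroup.mem_subgroupOf]
    by_cases ht : t ∈ Subgroup.centralizer {s}
    · have hst : Commute s t := (Subgroup.mem_centralizer_singleton_iff.1 ht).symm
      split_ifs with h₁ h₂ h₂
      · rw [coeff_act_of_commute hst, coeff_x, if_pos rfl, hreg t ht h₁, div_self', Units.val_one,
          mul_one]
      · exact absurd ⟨ht, h₁⟩ h₂
      · exact absurd h₂.2 h₁
      · exact map_zero _
    · obtain ⟨c, hc⟩ := act_x α t s
      have hne : t * s * t⁻¹ ≠ s := fun h =>
        ht (Subgroup.mem_centralizer_singleton_iff.2 (mul_inv_eq_iff_eq_mul.1 h))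
      simp only [ht, false_and, if_false, hc, apply_ite (coeff s), map_smul, coeff_x, if_neg hne,
        smul_zero, map_zero, ite_self]
  rw [ev_doubleCosetSum, map_sum, Fintype.sum_congr _ _ hterm, ← Finset.sum_filter,
    Finset.sum_const, nsmul_eq_mul, mul_one, ← Fintype.card_subtype, ← Nat.card_eq_fintype_card]

theorem exists_coeff_ne_zero_of_isRegularPair [Finite S] (hα : α.IsNondegenerate) {q : G} {s : S}
    (hreg : IsRegularPair α F (q⁻¹, s)) :
    ∃ a ∈ FixedPoints.subalgebra k (galoisAlgebra S α) F, coeff s (ev q a) ≠ 0 := by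
  have := Fintype.ofFinite S
  refine ⟨_, doubleCosetSum_mem_fixedPoints q (x α s), ?_⟩
  rw [coeff_ev_doubleCosetSum_x hreg]
  obtain ⟨m, hm⟩ := Subgroup.card_subgroup_dvd_card
    (Subgroup.centralizer {s} ⊓ (conjInv q⁻¹ F).subgroupOf S)
  have hcard : (Nat.card S : k) ≠ 0 := natCast_card_ne_zero hα
  rw [hm, Nat.cast_mul] at hcard
  exact left_ne_zero_of_mul hcard

theorem forall_miyashitaUlbrich_mem_fixedPoints_iff [Fintype G] [DecidableEq G]
    (hα : α.IsNondegenerate) (hA : IsGaloisObject k G (galoisAlgebra S α)) {a : galoisAlgebra S α}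
    (ha : a ∈ FixedPoints.subalgebra k (galoisAlgebra S α) F) :
    (∀ h, hA.miyashitaUlbrich a h ∈ FixedPoints.subalgebra k (galoisAlgebra S α) F) ↔
      ∀ (q : G) (s : S), coeff s (ev q a) ≠ 0 →
        conjInv q⁻¹ F ≤ Subgroup.centralizer {(s : G)} := by
  simp only [mem_fixedPoints_iff]
  refine ⟨fun H q s hs r hr => ?_, fun H h q r hr => ext_coeff fun s => ?_⟩
  · have heq := congrArg (coeff s) (H (Pi.single (q⁻¹ * s * q) 1) q r hr)
    rw [coeff_ev_miyashitaUlbrich hα, coeff_ev_miyashitaUlbrich hα,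
      mem_fixedPoints_iff.1 ha q r hr, Pi.single_eq_same, mul_left_inj' hs] at heq
    have hconj : (r * q)⁻¹ * s * (r * q) = q⁻¹ * s * q := by
      by_contra hne
      rw [Pi.single_eq_of_ne hne] at heq
      exact zero_ne_one heq
    exact Subgroup.mem_centralizer_singleton_iff.2 (inv_conj_mul_eq_iff.1 hconj)
  · rw [coeff_ev_miyashitaUlbrich hα, coeff_ev_miyashitaUlbrich hα,
      mem_fixedPoints_iff.1 ha q r hr]
    by_cases hs : coeff s (ev q a) = 0
    · rw [hs, mul_zero, mul_zero]
    · have hrs := Subgroup.mem_centralizer_singleton_iff.1 (H q s hs hr)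
      rw [inv_conj_mul_eq_iff.2 hrs]

end FixedPoints

end galoisAlgebra

end

theorem theorem5p1_general {k : Type*} [Field k] {G : Type*} [Group G] [Fintype G] [DecidableEq G]
    (S : Subgroup G) (α : TwoCocycle S k) (hα : α.IsNondegenerate) (F : Subgroup G) :
    ∃ hA : IsGaloisObject k G (galoisAlgebra S α),
      hA.IsMUSubmodule (FixedPoints.subalgebra k (galoisAlgebra S α) F).toSubmodule ↔
        ∀ (g : G) (s : S), IsRegularClass α F (BalancedProduct.mk g s) →
          conjInv g F ≤ Subgroup.centralizer {(s : G)} := by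
  refine ⟨galoisAlgebra.isGaloisObject hα, fun H g s hreg => ?_, fun H a ha => ?_⟩
  · rw [← inv_inv g] at hreg ⊢
    obtain ⟨a, ha, hs⟩ := galoisAlgebra.exists_coeff_ne_zero_of_isRegularPair hα hreg
    exact (galoisAlgebra.forall_miyashitaUlbrich_mem_fixedPoints_iff hα _ ha).1 (H a ha) _ _ hs
  · refine (galoisAlgebra.forall_miyashitaUlbrich_mem_fixedPoints_iff hα _ ha).2 fun q s hs => ?_
    exact H q⁻¹ s (galoisAlgebra.isRegularPair_of_coeff_ne_zero ha hs)

theorem theorem5p1 {k : Type*} [Field k] [IsAlgClosed k] [CharZero k]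
    {G : Type*} [Group G] [Fintype G] [DecidableEq G]
    (S : Subgroup G) (α : TwoCocycle S k) (hα : α.IsNondegenerate) (F : Subgroup G) :
    ∃ hA : IsGaloisObject k G (galoisAlgebra S α),
      hA.IsMUSubmodule (FixedPoints.subalgebra k (galoisAlgebra S α) F).toSubmodule ↔
        ∀ (g : G) (s : S), IsRegularClass α F (BalancedProduct.mk g s) →
          conjInv g F ≤ Subgroup.centralizer {(s : G)} :=
  theorem5p1_general S α hα F
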